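/- Let $m,n\ge 1$ be integers, $1<p<q<\infty$, $p'=\frac{p}{p-1}$, $q'=\frac{q}{q-1}$, and let $\alpha,\beta$ be real numbers with $0<\frac{\alpha}{m},\frac{\beta}{n}<1$ and $$\frac1p-\frac1q<\min\left\{\frac{\alpha}{m},\frac{\beta}{n}\right\}.$$ A rectangle is a product $R=I\times J$ of cubes $I\subset\mathbb R^m$, $J\subset\mathbb R^n$ with sides parallel to the axes; $sI$ denotes the concentric dilate of $I$ by $s>0$, and $2R=2I\times 2J$. For positive Borel measures $\mu,\sigma,\omega$ on $\mathbb R^m\times\mathbb R^n$ put $$I_{\alpha,\beta}\mu(x,y)=\iint |x-u|^{\alpha-m}|y-t|^{\beta-n}\,d\mu(u,t),$$ $$\mathbb A(\sigma,\omega)=\sup_{I,J}|I|^{\frac{\alpha}{m}-1}|J|^{\frac{\beta}{n}-1}\,\omega(I\times J)^{\frac1q}\,\sigma(I\times J)^{\frac1{p'}} .$$ The measure $\mu$ is product doubling with constant $D$ if $\mu(2R)\le D\,\mu(R)$ for all rectangles $R$, and has product reverse doubling exponent $(\varepsilon,\varepsilon')$ with constant $K$ if $\mu(sI\times tJ)\le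 K s^{m\varepsilon}t^{n\varepsilon'}\mu(I\times J)$ for all rectangles $I\times J$ and all $0<s,t<1$. Suppose that $$1-\frac{\alpha}{m}<\varepsilon<\frac{1-\frac{\alpha}{m}}{\frac1q+\frac1{p'}}\quad\text{and}\quad 1-\frac{\beta}{n}<\varepsilon'<\frac{1-\frac{\beta}{n}}{\frac1q+\frac1{p'}},$$ and let $D,K\ge 0$. Then there is a finite constant $C$, depending only on $m,n,\alpha,\beta,p,q,\varepsilon,\varepsilon',D,K$, such that the following holds. If $\sigma,\omega$ are locally finite positive Borel measures on $\mathbb R^m\times\mathbb R^n$, both product doubling with constant $D$ and both having product reverse doubling exponent $(\varepsilon,\varepsilon')$ with constant $K$, and if $\mathbb A(\sigma,\omega)<\infty$, then for all rectangles $R$, $$\left\{\iint I_{\alpha,\beta}(\mathbf 1_R\sigma)^q\,d\omega\right\}^{\frac1q}\le C\,\mathbb A(\sigma,\omega)\,\sigma(R)^{\frac1p},$$ $$\left\{\iint I_{\alpha,\beta}(\mathbf 1_R\omega)^{p'}\,d\sigma\right\}^{\frac1{p'}}\le C\,\mathbb A(\sigma,\omega)\,\omega(R)^{\frac1{q'}}.$$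 -/

import Mathlib

open MeasureTheory
open scoped NNReal ENNReal

/-- The closed cube in `ℝᵈ` with sides parallel to the axes, center `c` and side length `l`.
The concentric dilate `s I` of `I = cube c l` is `cube c (s * l)`. -/
def cube {d : ℕ} (c : EuclideanSpace ℝ (Fin d)) (l : ℝ) : Set (EuclideanSpace ℝ (Fin d)) :=
  {x | ∀ i, |x i - c i| ≤ l / 2}

/-- The rectangle `I × J` in `ℝᵐ × ℝⁿ`, where `I` is the cube with center `a` and side length `l`
and `J` is the cube with center `b` and side length `r`. -/
def rect {m n : ℕ} (a : EuclideanSpace ℝ (Fin m)) (l : ℝ) (b : EuclideanSpace ℝ (Fin n)) (r : ℝ) :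
    Set (EuclideanSpace ℝ (Fin m) × EuclideanSpace ℝ (Fin n)) :=
  cube a l ×ˢ cube b r

/-- The product fractional integral of a positive measure `μ`,
`I_{α,β} μ (x, y) = ∬ |x - u|^(α - m) |y - t|^(β - n) dμ(u, t)`, with values in `[0, ∞]`.
For `α < m` and `β < n` the kernel is `∞` where `x = u` or `y = t`. -/
noncomputable def fracInt {m n : ℕ} (α β : ℝ)
    (μ : Measure (EuclideanSpace ℝ (Fin m) × EuclideanSpace ℝ (Fin n)))
    (z : EuclideanSpace ℝ (Fin m) × EuclideanSpace ℝ (Fin n)) : ℝ≥0∞ :=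
  ∫⁻ v, ‖z.1 - v.1‖ₑ ^ (α - (m : ℝ)) * ‖z.2 - v.2‖ₑ ^ (β - (n : ℝ)) ∂μ

/-- The rectangle characteristic: the supremum over all cubes `I ⊆ ℝᵐ`, `J ⊆ ℝⁿ` of
`|I|^(α/m - 1) |J|^(β/n - 1) ω(I × J)^(1/q) σ(I × J)^(1/p')`, where `p' = p / (p - 1)`. -/
noncomputable def rectChar {m n : ℕ} (α β p q : ℝ)
    (σ ω : Measure (EuclideanSpace ℝ (Fin m) × EuclideanSpace ℝ (Fin n))) : ℝ≥0∞ :=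
  ⨆ (a : EuclideanSpace ℝ (Fin m)) (l : ℝ) (_ : 0 < l)
    (b : EuclideanSpace ℝ (Fin n)) (r : ℝ) (_ : 0 < r),
    volume (cube a l) ^ (α / m - 1) * volume (cube b r) ^ (β / n - 1) *
      ω (rect a l b r) ^ (1 / q) * σ (rect a l b r) ^ (1 / p.conjExponent)

/-- Product doubling with constant `D`: `μ(2R) ≤ D μ(R)` for all rectangles `R`. -/
def ProductDoubling {m n : ℕ} (D : ℝ≥0)
    (μ : Measure (EuclideanSpace ℝ (Fin m) × EuclideanSpace ℝ (Fin n))) : Prop :=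
  ∀ (a : EuclideanSpace ℝ (Fin m)) (l : ℝ) (b : EuclideanSpace ℝ (Fin n)) (r : ℝ),
    0 < l → 0 < r → μ (rect a (2 * l) b (2 * r)) ≤ D * μ (rect a l b r)

/-- Product reverse doubling with exponent pair `(ε, ε')` and constant `K`:
`μ(sI × tJ) ≤ K s^(mε) t^(nε') μ(I × J)` for all rectangles `I × J` and all `0 < s, t < 1`. -/
def ProductReverseDoubling {m n : ℕ} (ε ε' : ℝ) (K : ℝ≥0)
    (μ : Measure (EuclideanSpace ℝ (Fin m) × EuclideanSpace ℝ (Fin n))) : Prop :=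
  ∀ (a : EuclideanSpace ℝ (Fin m)) (l : ℝ) (b : EuclideanSpace ℝ (Fin n)) (r : ℝ) (s t : ℝ),
    0 < l → 0 < r → 0 < s → s < 1 → 0 < t → t < 1 →
      μ (rect a (s * l) b (t * r)) ≤
        K * ENNReal.ofReal (s ^ (m * ε) * t ^ (n * ε')) * μ (rect a l b r)

section

/-! ### Cubes, rectangles and dyadic shells -/

variable {m n d : ℕ}

/-! Sort the points `z` by the pair `(k, j)` of dyadic shells around `R` that contain their two
components. On that shell `I_{α,β}(1_R σ)` is at most a constant times `(2^k l)^(α-m) (2^j r)^(β-n)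
σ(R)`. In a distant variable the kernel has this size on all of `R`. In a near variable it is a sum
over cubes shrinking to `z`, and reverse doubling with `ε > 1 - α/m`, `ε' > 1 - β/n` makes the sum
geometric (`exists_kernel_le_tsum`, `fracInt_restrict_le`).

Integrate against `ω` and split `σ(R) = σ(R)^s σ(R)^(1-s)`. Reverse doubling bounds `σ(R)^s` by
`σ(S)^s` times a geometric factor in `k` and `j`, where `S` is the dilate of `R` with sides `2^k l`,
`2^j r`. The rectangle condition on `S` absorbs the rest, and the sum over shells converges
(`exists_testing_const`). The condition is symmetric in the two measures, so the dual inequality is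
the same statement with the roles exchanged. -/

theorem mem_cube {c x : EuclideanSpace ℝ (Fin d)} {l : ℝ} :
    x ∈ cube c l ↔ ∀ i, |x i - c i| ≤ l / 2 := Iff.rfl

theorem cube_mono (c : EuclideanSpace ℝ (Fin d)) {l l' : ℝ} (h : l ≤ l') :
    cube c l ⊆ cube c l' := fun _ hx i => (hx i).trans (by linarith)

theorem cube_subset_cube {c x : EuclideanSpace ℝ (Fin d)} {l s t : ℝ} (hx : x ∈ cube c l)
    (h : l + s ≤ t) : cube x s ⊆ cube c t := fun u hu i => by
  have := abs_sub_le (u i) (x i) (c i)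
  linarith [hu i, hx i]

theorem isClosed_cube (c : EuclideanSpace ℝ (Fin d)) (l : ℝ) : IsClosed (cube c l) := by
  have : cube c l = ⋂ i, {x | |x i - c i| ≤ l / 2} := by ext; simp [mem_cube]
  rw [this]
  exact isClosed_iInter fun i => isClosed_le (by fun_prop) continuous_const

theorem measurableSet_rect (a : EuclideanSpace ℝ (Fin m)) (l : ℝ) (b : EuclideanSpace ℝ (Fin n))
    (r : ℝ) : MeasurableSet (rect a l b r) :=
  (isClosed_cube a l).measurableSet.prod (isClosed_cube b r).measurableSet

theorem volume_cube (c : EuclideanSpace ℝ (Fin d)) (l : ℝ) :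
    volume (cube c l) = ENNReal.ofReal l ^ d := by
  have h : cube c l = (MeasurableEquiv.toLp 2 (Fin d → ℝ)).symm ⁻¹'
      (Set.univ.pi fun i => Set.Icc (c i - l / 2) (c i + l / 2)) := by
    ext x
    simp only [mem_cube, Set.mem_preimage, Set.mem_pi, Set.mem_univ, true_imp_iff, Set.mem_Icc,
      abs_le]
    refine forall_congr' fun i => ?_
    change _ ↔ c i - l / 2 ≤ x i ∧ x i ≤ c i + l / 2
    constructor <;> rintro ⟨h₁, h₂⟩ <;> constructor <;> linarith
  rw [h, (EuclideanSpace.volume_preserving_symm_measurableEquiv_toLp (Fin d)).measure_preimage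
    (MeasurableSet.univ_pi fun i => measurableSet_Icc).nullMeasurableSet, volume_pi_pi]
  simp [Real.volume_Icc, ← two_mul, mul_div_cancel₀]

/-- The first dyadic dilate of a cube which contains a given point. -/
theorem exists_dyadic_shell (a x : EuclideanSpace ℝ (Fin d)) {l : ℝ} (hl : 0 < l) :
    ∃ k : ℕ, x ∈ cube a (2 ^ k * l) ∧ ∀ j < k, x ∉ cube a (2 ^ j * l) := by
  classical
  have h : ∃ k : ℕ, x ∈ cube a (2 ^ k * l) := by
    obtain ⟨k, hk⟩ := pow_unbounded_of_one_lt (2 * ‖x - a‖ / l) (one_lt_two : (1 : ℝ) < 2)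
    refine ⟨k, fun i => ?_⟩
    have h₁ := PiLp.norm_apply_le (x - a) i
    rw [div_lt_iff₀ hl] at hk
    simp only [PiLp.sub_apply, Real.norm_eq_abs] at h₁
    linarith
  exact ⟨Nat.find h, Nat.find_spec h, fun j hj => Nat.find_min h hj⟩

theorem lt_norm_sub_of_notMem_cube {a x : EuclideanSpace ℝ (Fin d)} {l : ℝ}
    (h : x ∉ cube a l) : l / 2 < ‖x - a‖ := by
  simp only [mem_cube, not_forall, not_le] at h
  obtain ⟨i, hi⟩ := h
  exact hi.trans_le (by simpa using PiLp.norm_apply_le (x - a) i)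

/-! ### Dyadic domination of the kernel -/

theorem enorm_rpow_neg_le {E : Type*} [SeminormedAddCommGroup E] {x : E} {t γ : ℝ} (hγ : 0 ≤ γ)
    (h : t ≤ ‖x‖) : ‖x‖ₑ ^ (-γ) ≤ ENNReal.ofReal t ^ (-γ) := by
  rw [ENNReal.rpow_neg, ENNReal.rpow_neg, ← ofReal_norm]
  gcongr

/-- Dyadic majorant of the Riesz kernel on a cube, seen from the dyadic shell of index `k`. -/
theorem exists_kernel_le_tsum {γ : ℝ} (hγ : 0 < γ) (a x : EuclideanSpace ℝ (Fin d)) {l : ℝ}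
    (hl : 0 < l) {k : ℕ} (hk : x ∈ cube a (2 ^ k * l)) (hk' : ∀ j < k, x ∉ cube a (2 ^ j * l)) :
    ∃ x' ∈ cube a (2 * l), ∀ u ∈ cube a l, ‖x - u‖ₑ ^ (-γ) ≤
      8 ^ γ * ENNReal.ofReal (2 ^ k * l) ^ (-γ) *
        ∑' i : ℕ, (2 ^ γ) ^ i * (cube x' (4 * l / 2 ^ i)).indicator 1 u := by
  -- The 8 serves both regimes: `t = l / 2^N` with `k ≤ 1`, and `t = 2^(k-2) l / 2` with `N = 0`,
  -- where equality holds.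
  have key : ∀ (t : ℝ), 0 < t → ∀ N : ℕ, 2 ^ k * l ≤ 8 * 2 ^ N * t →
      ENNReal.ofReal t ^ (-γ) ≤
        8 ^ γ * ENNReal.ofReal (2 ^ k * l) ^ (-γ) * ((2 : ℝ≥0∞) ^ γ) ^ N := by
    intro t ht N hN
    have h₁ : ENNReal.ofReal (2 ^ k * l) ^ γ ≤
        8 ^ γ * (2 ^ γ) ^ N * ENNReal.ofReal t ^ γ := by
      calc ENNReal.ofReal (2 ^ k * l) ^ γ ≤ ENNReal.ofReal (8 * 2 ^ N * t) ^ γ := by gcongr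
        _ = _ := by
          rw [ENNReal.ofReal_mul (by positivity), ENNReal.ofReal_mul (by positivity),
            ENNReal.ofReal_pow (by positivity), ENNReal.mul_rpow_of_nonneg _ _ hγ.le,
            ENNReal.mul_rpow_of_nonneg _ _ hγ.le, ← ENNReal.rpow_natCast,
            ← ENNReal.rpow_natCast, ← ENNReal.rpow_mul, ← ENNReal.rpow_mul, mul_comm (N : ℝ)]
          norm_num
    have ht0 : ENNReal.ofReal t ^ γ ≠ 0 := by
      simp [ENNReal.rpow_eq_zero_iff, ht, not_lt.2 hγ.le]
    have htt : ENNReal.ofReal t ^ γ ≠ ∞ := by finiteness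
    have hk0 : ENNReal.ofReal (2 ^ k * l) ^ γ ≠ 0 := by
      have : 0 < 2 ^ k * l := by positivity
      simp [ENNReal.rpow_eq_zero_iff, hl, not_lt.2 hγ.le]
    have hkt : ENNReal.ofReal (2 ^ k * l) ^ γ ≠ ∞ := by finiteness
    rw [ENNReal.rpow_neg, ENNReal.rpow_neg]
    calc (ENNReal.ofReal t ^ γ)⁻¹
        = (ENNReal.ofReal t ^ γ)⁻¹ *
            (ENNReal.ofReal (2 ^ k * l) ^ γ * (ENNReal.ofReal (2 ^ k * l) ^ γ)⁻¹) := by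
          rw [ENNReal.mul_inv_cancel hk0 hkt, mul_one]
      _ ≤ (ENNReal.ofReal t ^ γ)⁻¹ *
            (8 ^ γ * (2 ^ γ) ^ N * ENNReal.ofReal t ^ γ *
              (ENNReal.ofReal (2 ^ k * l) ^ γ)⁻¹) := by gcongr
      _ = (ENNReal.ofReal t ^ γ)⁻¹ * ENNReal.ofReal t ^ γ *
            (8 ^ γ * (ENNReal.ofReal (2 ^ k * l) ^ γ)⁻¹ * (2 ^ γ) ^ N) := by ring
      _ = _ := by rw [ENNReal.inv_mul_cancel ht0 htt, one_mul]
  -- Near regime: the singularity may meet the cube, so the shrinking cubes are centered at `x`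
  -- itself.
  rcases le_or_gt k 1 with hk1 | hk1
  · have h2k : (2 : ℝ) ^ k ≤ 2 := by
      simpa using pow_le_pow_right₀ (one_le_two : (1 : ℝ) ≤ 2) hk1
    have hx2 : x ∈ cube a (2 * l) := cube_mono a (by gcongr) hk
    refine ⟨x, hx2, fun u hu => ?_⟩
    have hbase : u ∈ cube x (4 * l) := fun i => by
      have := abs_sub_le (u i) (a i) (x i)
      have := hx2 i
      rw [abs_sub_comm] at this
      linarith [hu i]
    by_cases hux : ∀ i : ℕ, u ∈ cube x (4 * l / 2 ^ i)
    -- This covers `u = x`, where the kernel is infinite; the majorant diverges because each term is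
    -- at least 1.
    · have htop : ∑' i : ℕ, (2 ^ γ) ^ i * (cube x (4 * l / 2 ^ i)).indicator 1 u = (∞ : ℝ≥0∞) := by
        rw [← top_le_iff, ← ENNReal.tsum_const_eq_top_of_ne_zero (α := ℕ) (c := 1) one_ne_zero]
        refine ENNReal.tsum_le_tsum fun i => ?_
        rw [Set.indicator_of_mem (hux i), Pi.one_apply, mul_one]
        exact one_le_pow₀ (ENNReal.one_le_rpow one_le_two hγ)
      rw [htop, ENNReal.mul_top]
      · exact le_top
      · refine mul_ne_zero ?_ ?_
        · simp [ENNReal.rpow_eq_zero_iff]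
        · rw [ENNReal.rpow_neg]
          simp only [ne_eq, ENNReal.inv_eq_zero]
          finiteness
    · push Not at hux
      classical
      -- `N` is the last scale whose cube contains `u`; leaving the next one gives `‖x - u‖ > l /
      -- 2^N`.
      obtain ⟨N, hN⟩ : ∃ N, Nat.find hux = N + 1 := by
        refine Nat.exists_eq_succ_of_ne_zero fun h0 => ?_
        have := Nat.find_spec hux
        rw [h0] at this
        exact this (by simpa using hbase)
      have hN1 : u ∉ cube x (4 * l / 2 ^ (N + 1)) := hN ▸ Nat.find_spec hux
      have hN0 : u ∈ cube x (4 * l / 2 ^ N) :=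
        not_not.1 (Nat.find_min hux (m := N) (by omega))
      have hlt := lt_norm_sub_of_notMem_cube hN1
      have heq : 4 * l / 2 ^ (N + 1) / 2 = l / 2 ^ N := by
        rw [pow_succ]; field_simp; norm_num
      rw [heq, norm_sub_rev] at hlt
      calc ‖x - u‖ₑ ^ (-γ) ≤ ENNReal.ofReal (l / 2 ^ N) ^ (-γ) := enorm_rpow_neg_le hγ.le hlt.le
        _ ≤ 8 ^ γ * ENNReal.ofReal (2 ^ k * l) ^ (-γ) * ((2 : ℝ≥0∞) ^ γ) ^ N := by
          refine key _ (by positivity) N ?_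
          have : 8 * 2 ^ N * (l / 2 ^ N) = 8 * l := by field_simp
          rw [this]
          gcongr
          linarith
        _ ≤ _ := by
          gcongr
          refine le_trans ?_ (ENNReal.le_tsum N)
          rw [Set.indicator_of_mem hN0, Pi.one_apply, mul_one]
  -- Far regime: there is no singularity, so the term `i = 0` suffices. The center `a` keeps that
  -- cube close to the original one.
  · refine ⟨a, fun i => by simp [hl.le], fun u hu => ?_⟩
    obtain ⟨j, rfl⟩ : ∃ j, k = j + 2 := ⟨k - 2, by omega⟩
    obtain ⟨i, hi⟩ : ∃ i, ¬ |x i - a i| ≤ 2 ^ (j + 1) * l / 2 := by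
      simpa [mem_cube] using hk' (j + 1) (by omega)
    have h1 : 2 ^ j * l / 2 ≤ ‖x - u‖ := by
      have h2 := PiLp.norm_apply_le (x - u) i
      simp only [PiLp.sub_apply, Real.norm_eq_abs] at h2
      have h3 := abs_sub_le (x i) (u i) (a i)
      have h4 := hu i
      have h5 : l ≤ 2 ^ j * l := le_mul_of_one_le_left hl.le (one_le_pow₀ one_le_two)
      rw [pow_succ] at hi
      push Not at hi
      linarith
    calc ‖x - u‖ₑ ^ (-γ) ≤ ENNReal.ofReal (2 ^ j * l / 2) ^ (-γ) := enorm_rpow_neg_le hγ.le h1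
      _ ≤ 8 ^ γ * ENNReal.ofReal (2 ^ (j + 2) * l) ^ (-γ) * ((2 : ℝ≥0∞) ^ γ) ^ 0 := by
        refine key _ (by positivity) 0 (le_of_eq ?_)
        ring
      _ ≤ _ := by
        gcongr
        refine le_trans ?_ (ENNReal.le_tsum 0)
        rw [Set.indicator_of_mem, Pi.one_apply, mul_one]
        exact cube_mono a (by simp; linarith) hu

/-! ### Dyadic reverse doubling and the pointwise bound -/

theorem ofReal_two_rpow (x : ℝ) : ENNReal.ofReal (2 ^ x) = 2 ^ x := by
  rw [← ENNReal.ofReal_rpow_of_pos two_pos]; simp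

/-- Dyadic form of reverse doubling, including the trivial scales. -/
theorem ProductReverseDoubling.dyadic {ε ε' : ℝ} {D K : ℝ≥0} (hε : 0 ≤ ε) (hε' : 0 ≤ ε')
    {μ : Measure (EuclideanSpace ℝ (Fin m) × EuclideanSpace ℝ (Fin n))}
    (hμ : ProductReverseDoubling ε ε' K μ) (hD : ProductDoubling D μ)
    (a : EuclideanSpace ℝ (Fin m)) {l : ℝ} (hl : 0 < l) (b : EuclideanSpace ℝ (Fin n)) {r : ℝ}
    (hr : 0 < r) (i j : ℕ) :
    μ (rect a (l / 2 ^ i) b (r / 2 ^ j)) ≤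
      K * D * ((2 : ℝ≥0∞) ^ (-(m * ε))) ^ i * ((2 : ℝ≥0∞) ^ (-(n * ε'))) ^ j *
        μ (rect a l b r) := by
  -- Reverse doubling requires both ratios to be strictly below 1, which fails at `i = 0` or `j =
  -- 0`. Starting from the doubled rectangle shifts each exponent by one, at the cost of a factor
  -- `D`.
  have h := hμ a (2 * l) b (2 * r) (2⁻¹ ^ (i + 1)) (2⁻¹ ^ (j + 1)) (by positivity) (by positivity)
    (by positivity) (pow_lt_one₀ (by norm_num) (by norm_num) (by omega))
    (by positivity) (pow_lt_one₀ (by norm_num) (by norm_num) (by omega))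
  have e₁ : ∀ (i : ℕ) (l : ℝ), (2⁻¹ : ℝ) ^ (i + 1) * (2 * l) = l / 2 ^ i := fun i l => by
    rw [pow_succ, inv_pow]; field_simp
  have e₂ : ∀ (i : ℕ) {x : ℝ}, 0 ≤ x → ((2⁻¹ : ℝ) ^ (i + 1)) ^ x ≤ (2 ^ (-x)) ^ i := fun i x hx => by
    rw [← Real.rpow_natCast, ← Real.rpow_natCast, ← Real.rpow_mul (by norm_num),
      ← Real.rpow_mul (by norm_num), Real.inv_rpow (by norm_num), ← Real.rpow_neg (by norm_num)]
    refine Real.rpow_le_rpow_of_exponent_le one_le_two ?_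
    push_cast
    nlinarith
  rw [e₁, e₁] at h
  calc _ ≤ _ := h
    _ ≤ K * ENNReal.ofReal ((2 ^ (-(m * ε))) ^ i * (2 ^ (-(n * ε'))) ^ j) *
        (D * μ (rect a l b r)) := by
      gcongr
      · exact e₂ i (by positivity)
      · exact e₂ j (by positivity)
      · exact hD a l b r hl hr
    _ = _ := by
      rw [ENNReal.ofReal_mul (by positivity), ENNReal.ofReal_pow (by positivity),
        ENNReal.ofReal_pow (by positivity), ofReal_two_rpow, ofReal_two_rpow]
      ring

/-- Bound for the fractional integral of `1_R σ` on the dyadic shell `(k, j)` around `R`. -/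
theorem fracInt_restrict_le {α β ε ε' : ℝ} {D K : ℝ≥0} (hα : α < m) (hβ : β < n)
    (hε : 0 ≤ ε) (hε' : 0 ≤ ε')
    {σ : Measure (EuclideanSpace ℝ (Fin m) × EuclideanSpace ℝ (Fin n))}
    (hσ : ProductReverseDoubling ε ε' K σ) (hD : ProductDoubling D σ)
    (a : EuclideanSpace ℝ (Fin m)) {l : ℝ} (hl : 0 < l) (b : EuclideanSpace ℝ (Fin n)) {r : ℝ}
    (hr : 0 < r) {z : EuclideanSpace ℝ (Fin m) × EuclideanSpace ℝ (Fin n)} {k j : ℕ}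
    (hk : z.1 ∈ cube a (2 ^ k * l)) (hk' : ∀ i < k, z.1 ∉ cube a (2 ^ i * l))
    (hj : z.2 ∈ cube b (2 ^ j * r)) (hj' : ∀ i < j, z.2 ∉ cube b (2 ^ i * r)) :
    fracInt α β (σ.restrict (rect a l b r)) z ≤
      (8 ^ (m - α) * 8 ^ (n - β) * K * D ^ 4 *
        (∑' i : ℕ, ((2 : ℝ≥0∞) ^ (m - α - m * ε)) ^ i) *
        (∑' i : ℕ, ((2 : ℝ≥0∞) ^ (n - β - n * ε')) ^ i)) *
      (ENNReal.ofReal (2 ^ k * l) ^ (α - m) * ENNReal.ofReal (2 ^ j * r) ^ (β - n)) *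
        σ (rect a l b r) := by
  obtain ⟨x, hx, hxu⟩ := exists_kernel_le_tsum (sub_pos.2 hα) a z.1 hl hk hk'
  obtain ⟨y, hy, hyu⟩ := exists_kernel_le_tsum (sub_pos.2 hβ) b z.2 hr hj hj'
  rw [neg_sub] at hxu hyu
  -- Since `x` lies in the double of the cube, sides `2l + 4l ≤ 8l` fit after three doublings; a
  -- fourth `D` comes from the dyadic reverse doubling.
  have hD8 : σ (rect x (4 * l) y (4 * r)) ≤ D ^ 3 * σ (rect a l b r) :=
    calc σ (rect x (4 * l) y (4 * r)) ≤ σ (rect a (2 * (2 * (2 * l))) b (2 * (2 * (2 * r)))) :=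
          measure_mono (Set.prod_mono (cube_subset_cube hx (by linarith))
            (cube_subset_cube hy (by linarith)))
      _ ≤ D * (D * (D * σ (rect a l b r))) := by
          refine (hD _ _ _ _ (by positivity) (by positivity)).trans ?_
          gcongr
          refine (hD _ _ _ _ (by positivity) (by positivity)).trans ?_
          gcongr
          exact hD _ _ _ _ hl hr
      _ = _ := by ring
  set A : ℝ≥0∞ := 8 ^ (m - α) * ENNReal.ofReal (2 ^ k * l) ^ (α - m)
  set B : ℝ≥0∞ := 8 ^ (n - β) * ENNReal.ofReal (2 ^ j * r) ^ (β - n)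
  have e₁ : ∀ γ κ : ℝ, (2 : ℝ≥0∞) ^ (γ - κ) = 2 ^ γ * 2 ^ (-κ) := fun γ κ => by
    rw [sub_eq_add_neg, ENNReal.rpow_add _ _ two_ne_zero ENNReal.ofNat_ne_top]
  calc fracInt α β (σ.restrict (rect a l b r)) z
      ≤ ∫⁻ v, A * B * ∑' i : ℕ, ∑' i' : ℕ, (2 ^ (m - α)) ^ i * (2 ^ (n - β)) ^ i' *
          (rect x (4 * l / 2 ^ i) y (4 * r / 2 ^ i')).indicator 1 v ∂σ := by
        refine (setLIntegral_mono_ae' (measurableSet_rect a l b r) (Filter.Eventually.of_forall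
          fun v hv => ?_)).trans (setLIntegral_le_lintegral _ _)
        calc _ ≤ _ := mul_le_mul' (hxu v.1 hv.1) (hyu v.2 hv.2)
          _ = A * B * ((∑' i : ℕ, (2 ^ (m - α)) ^ i * (cube x (4 * l / 2 ^ i)).indicator 1 v.1) *
            (∑' i : ℕ, (2 ^ (n - β)) ^ i * (cube y (4 * r / 2 ^ i)).indicator 1 v.2)) := by ring
          _ = _ := by
            congr 1
            rw [← ENNReal.tsum_mul_right]
            refine tsum_congr fun i => ?_
            rw [← ENNReal.tsum_mul_left]
            refine tsum_congr fun i' => ?_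
            rw [mul_mul_mul_comm]
            congr 1
            classical
            simp only [Set.indicator_apply, rect, Set.mem_prod, Pi.one_apply, ite_and, mul_ite,
              mul_one, mul_zero]
            split_ifs <;> rfl
    _ = A * B * ∑' i : ℕ, ∑' i' : ℕ, (2 ^ (m - α)) ^ i * (2 ^ (n - β)) ^ i' *
          σ (rect x (4 * l / 2 ^ i) y (4 * r / 2 ^ i')) := by
        have hmeas : ∀ i i' : ℕ, Measurable
            fun v : EuclideanSpace ℝ (Fin m) × EuclideanSpace ℝ (Fin n) =>
              ((2 : ℝ≥0∞) ^ (m - α)) ^ i * (2 ^ (n - β)) ^ i' *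
              (rect x (4 * l / 2 ^ i) y (4 * r / 2 ^ i')).indicator 1 v := fun i i' =>
          (measurable_one.indicator (measurableSet_rect _ _ _ _)).const_mul _
        rw [lintegral_const_mul _ (Measurable.tsum fun i =>
          Measurable.tsum fun i' => hmeas i i'),
          lintegral_tsum fun i => (Measurable.tsum fun i' => hmeas i i').aemeasurable]
        congr 1
        refine tsum_congr fun i => ?_
        rw [lintegral_tsum fun i' => (hmeas i i').aemeasurable]
        refine tsum_congr fun i' => ?_
        rw [lintegral_const_mul _ (measurable_one.indicator (measurableSet_rect _ _ _ _)),
          lintegral_indicator_one (measurableSet_rect _ _ _ _)]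
    _ ≤ A * B * ∑' i : ℕ, ∑' i' : ℕ, (2 ^ (m - α)) ^ i * (2 ^ (n - β)) ^ i' *
          (K * D * ((2 : ℝ≥0∞) ^ (-(m * ε))) ^ i * ((2 : ℝ≥0∞) ^ (-(n * ε'))) ^ i' *
            (D ^ 3 * σ (rect a l b r))) := by
        gcongr with i i'
        refine (hσ.dyadic hε hε' hD x (by positivity) y (by positivity) i i').trans ?_
        gcongr
    _ = A * B * (((∑' i : ℕ, ((2 : ℝ≥0∞) ^ (m - α - m * ε)) ^ i) *
          (∑' i : ℕ, ((2 : ℝ≥0∞) ^ (n - β - n * ε')) ^ i)) *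
            (K * D ^ 4 * σ (rect a l b r))) := by
        congr 1
        simp_rw [e₁, ← ENNReal.tsum_mul_right]
        refine tsum_congr fun i => ?_
        rw [← ENNReal.tsum_mul_left, ← ENNReal.tsum_mul_right]
        refine tsum_congr fun i' => ?_
        ring
    _ = _ := by simp only [A, B]; ring

/-! ### The testing inequality -/

theorem tsum_two_rpow_pow_ne_top {x : ℝ} (hx : x < 0) : ∑' i : ℕ, ((2 : ℝ≥0∞) ^ x) ^ i ≠ ∞ := by
  rw [ENNReal.tsum_geometric]
  simp only [ne_eq, ENNReal.inv_eq_top, tsub_eq_zero_iff_le, not_le]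
  exact ENNReal.rpow_lt_one_of_one_lt_of_neg (by norm_num) hx

/-- Testing inequality for a pair of measures satisfying a rectangle condition with exponents
`1 / Q` and `s`. -/
theorem exists_testing_const {α β Q s ε ε' : ℝ} (hm : 1 ≤ m) (hn : 1 ≤ n) (hα : α < m)
    (hβ : β < n) (hQ : 0 < Q) (hs : 0 < s) (hs1 : s ≤ 1)
    (hε : 1 - α / m < ε) (hε' : 1 - β / n < ε') (D K : ℝ≥0) :
    ∃ C : ℝ≥0, ∀ (σ ω : Measure (EuclideanSpace ℝ (Fin m) × EuclideanSpace ℝ (Fin n)))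
      (A : ℝ≥0∞), ProductDoubling D σ → ProductReverseDoubling ε ε' K σ →
      (∀ a l b r, 0 < l → 0 < r → ENNReal.ofReal l ^ (α - m) * ENNReal.ofReal r ^ (β - n) *
        ω (rect a l b r) ^ (1 / Q) * σ (rect a l b r) ^ s ≤ A) →
      ∀ a l b r, 0 < l → 0 < r →
        (∫⁻ z, fracInt α β (σ.restrict (rect a l b r)) z ^ Q ∂ω) ^ (1 / Q) ≤
          C * A * σ (rect a l b r) ^ (1 - s) := by
  have hm0 : (0 : ℝ) < m := by exact_mod_cast hm
  have hn0 : (0 : ℝ) < n := by exact_mod_cast hn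
  have hε0 : 0 < ε := lt_trans (by rw [sub_pos, div_lt_one hm0]; exact hα) hε
  have hε0' : 0 < ε' := lt_trans (by rw [sub_pos, div_lt_one hn0]; exact hβ) hε'
  -- The lower bounds on `ε` and `ε'` say exactly that the local series have ratio below 1.
  have hmε : m - α - m * ε < 0 := by
    have := mul_lt_mul_of_pos_left hε hm0
    rw [mul_sub, mul_div_cancel₀ _ hm0.ne'] at this
    linarith
  have hnε : n - β - n * ε' < 0 := by
    have := mul_lt_mul_of_pos_left hε' hn0
    rw [mul_sub, mul_div_cancel₀ _ hn0.ne'] at this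
    linarith
  set C₁ : ℝ≥0∞ := 8 ^ (m - α) * 8 ^ (n - β) * K * D ^ 4 *
    (∑' i : ℕ, ((2 : ℝ≥0∞) ^ (m - α - m * ε)) ^ i) *
    (∑' i : ℕ, ((2 : ℝ≥0∞) ^ (n - β - n * ε')) ^ i) with hC₁
  have hC₁t : C₁ ≠ ∞ := by
    have h8 : ∀ x : ℝ, (8 : ℝ≥0∞) ^ x ≠ ∞ := fun x => by
      simp [ENNReal.rpow_eq_top_iff]
    exact ENNReal.mul_ne_top (ENNReal.mul_ne_top (by finiteness [h8 (m - α), h8 (n - β)])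
      (tsum_two_rpow_pow_ne_top hmε)) (tsum_two_rpow_pow_ne_top hnε)
  set T : ℝ≥0∞ := (∑' i : ℕ, ((2 : ℝ≥0∞) ^ (-(m * ε) * (s * Q))) ^ i) *
    ∑' i : ℕ, ((2 : ℝ≥0∞) ^ (-(n * ε') * (s * Q))) ^ i with hT
  have hTt : T ≠ ∞ := ENNReal.mul_ne_top
    (tsum_two_rpow_pow_ne_top (mul_neg_of_neg_of_pos (neg_neg_of_pos (by positivity))
      (by positivity)))
    (tsum_two_rpow_pow_ne_top (mul_neg_of_neg_of_pos (neg_neg_of_pos (by positivity))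
      (by positivity)))
  have hCt : C₁ * (K * D : ℝ≥0∞) ^ s * T ^ (1 / Q) ≠ ∞ := by finiteness
  refine ⟨(C₁ * (K * D : ℝ≥0∞) ^ s * T ^ (1 / Q)).toNNReal, fun σ ω A hD hK hA a l b r hl hr => ?_⟩
  rw [ENNReal.coe_toNNReal hCt]
  set S : ℕ → ℕ → Set (EuclideanSpace ℝ (Fin m) × EuclideanSpace ℝ (Fin n)) :=
    fun k j => rect a (2 ^ k * l) b (2 ^ j * r) with hS
  set X : ℕ → ℕ → ℝ≥0∞ := fun k j =>
    ENNReal.ofReal (2 ^ k * l) ^ (α - m) * ENNReal.ofReal (2 ^ j * r) ^ (β - n) with hX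
  set R := rect a l b r
  have hSm : ∀ k j, MeasurableSet (S k j) := fun k j => measurableSet_rect _ _ _ _
  -- Only the term of the shell containing `z` is needed; full dilates replace shells, which loses
  -- nothing essential as the sum is still geometric.
  have hpt : ∀ z, fracInt α β (σ.restrict R) z ^ Q ≤
      ∑' k : ℕ, ∑' j : ℕ, (C₁ * X k j * σ R) ^ Q * (S k j).indicator 1 z := fun z => by
    obtain ⟨k, hk, hk'⟩ := exists_dyadic_shell a z.1 hl
    obtain ⟨j, hj, hj'⟩ := exists_dyadic_shell b z.2 hr
    refine le_trans ?_ (ENNReal.le_tsum k)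
    refine le_trans ?_ (ENNReal.le_tsum j)
    rw [Set.indicator_of_mem (show z ∈ S k j from ⟨hk, hj⟩), Pi.one_apply, mul_one]
    gcongr
    exact fracInt_restrict_le hα hβ hε0.le hε0'.le hK hD a hl b hr hk hk' hj hj'
  have hterm : ∀ k j, (C₁ * X k j * σ R) ^ Q * ω (S k j) ≤
      (C₁ * (K * D : ℝ≥0∞) ^ s * A * σ R ^ (1 - s)) ^ Q *
        (((2 : ℝ≥0∞) ^ (-(m * ε) * (s * Q))) ^ k * ((2 : ℝ≥0∞) ^ (-(n * ε') * (s * Q))) ^ j) :=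
      fun k j => by
    have hσR : σ R ≤ K * D * ((2 : ℝ≥0∞) ^ (-(m * ε))) ^ k * ((2 : ℝ≥0∞) ^ (-(n * ε'))) ^ j *
        σ (S k j) := by
      have := hK.dyadic hε0.le hε0'.le hD a (l := 2 ^ k * l) (by positivity) b (r := 2 ^ j * r)
        (by positivity) k j
      rwa [mul_div_cancel_left₀ _ (by positivity), mul_div_cancel_left₀ _ (by positivity)] at this
    have e : ∀ (x : ℝ) (i : ℕ), ((((2 : ℝ≥0∞) ^ x) ^ i) ^ s) ^ Q = (2 ^ (x * (s * Q))) ^ i :=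
      fun x i => by
        simp only [← ENNReal.rpow_natCast, ← ENNReal.rpow_mul]
        ring_nf
    -- `σ R` may be 0 or `∞`; the split into powers is still valid because `s` and `1 - s` are
    -- nonnegative. Once `σ R ^ s` is moved to `S k j`, the rectangle expression of `S k j` appears
    -- and is at most `A`.
    calc (C₁ * X k j * σ R) ^ Q * ω (S k j)
        = (C₁ * X k j * (σ R ^ s * σ R ^ (1 - s)) * ω (S k j) ^ (1 / Q)) ^ Q := by
          rw [← ENNReal.rpow_add_of_nonneg _ _ hs.le (by linarith), add_sub_cancel,
            ENNReal.rpow_one, ENNReal.mul_rpow_of_nonneg _ (ω (S k j) ^ (1 / Q)) hQ.le,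
            ← ENNReal.rpow_mul, one_div_mul_cancel hQ.ne', ENNReal.rpow_one]
      _ ≤ (C₁ * X k j * ((K * D * ((2 : ℝ≥0∞) ^ (-(m * ε))) ^ k *
            ((2 : ℝ≥0∞) ^ (-(n * ε'))) ^ j * σ (S k j)) ^ s * σ R ^ (1 - s)) *
              ω (S k j) ^ (1 / Q)) ^ Q := by gcongr
      _ = (C₁ * (K * D : ℝ≥0∞) ^ s * (X k j * ω (S k j) ^ (1 / Q) * σ (S k j) ^ s) *
            σ R ^ (1 - s) * ((((2 : ℝ≥0∞) ^ (-(m * ε))) ^ k) ^ s *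
              (((2 : ℝ≥0∞) ^ (-(n * ε'))) ^ j) ^ s)) ^ Q := by
          rw [ENNReal.mul_rpow_of_nonneg _ (σ (S k j)) hs.le, ENNReal.mul_rpow_of_nonneg _ _ hs.le,
            ENNReal.mul_rpow_of_nonneg (K * D : ℝ≥0∞) _ hs.le]
          congr 1
          ring
      _ ≤ (C₁ * (K * D : ℝ≥0∞) ^ s * A *
            σ R ^ (1 - s) * ((((2 : ℝ≥0∞) ^ (-(m * ε))) ^ k) ^ s *
              (((2 : ℝ≥0∞) ^ (-(n * ε'))) ^ j) ^ s)) ^ Q := by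
          gcongr
          exact hA a _ b _ (by positivity) (by positivity)
      _ = _ := by
          rw [ENNReal.mul_rpow_of_nonneg _ (_ * _) hQ.le, ENNReal.mul_rpow_of_nonneg
            ((((2 : ℝ≥0∞) ^ (-(m * ε))) ^ k) ^ s) _ hQ.le, e, e]
  calc (∫⁻ z, fracInt α β (σ.restrict R) z ^ Q ∂ω) ^ (1 / Q)
      ≤ ((C₁ * (K * D : ℝ≥0∞) ^ s * A * σ R ^ (1 - s)) ^ Q * T) ^ (1 / Q) := by
        gcongr
        calc ∫⁻ z, fracInt α β (σ.restrict R) z ^ Q ∂ω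
            ≤ ∫⁻ z, ∑' k : ℕ, ∑' j : ℕ, (C₁ * X k j * σ R) ^ Q * (S k j).indicator 1 z ∂ω :=
              lintegral_mono hpt
          _ = ∑' k : ℕ, ∑' j : ℕ, (C₁ * X k j * σ R) ^ Q * ω (S k j) := by
              have hmeas : ∀ k j : ℕ, Measurable
                  fun z => (C₁ * X k j * σ R) ^ Q * (S k j).indicator 1 z := fun k j =>
                (measurable_one.indicator (hSm k j)).const_mul _
              rw [lintegral_tsum fun i => (Measurable.tsum fun i' => hmeas i i').aemeasurable]
              refine tsum_congr fun i => ?_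
              rw [lintegral_tsum fun i' => (hmeas i i').aemeasurable]
              refine tsum_congr fun i' => ?_
              rw [lintegral_const_mul _ (measurable_one.indicator (hSm _ _)),
                lintegral_indicator_one (hSm _ _)]
          _ ≤ ∑' k : ℕ, ∑' j : ℕ, (C₁ * (K * D : ℝ≥0∞) ^ s * A * σ R ^ (1 - s)) ^ Q *
                (((2 : ℝ≥0∞) ^ (-(m * ε) * (s * Q))) ^ k *
                  ((2 : ℝ≥0∞) ^ (-(n * ε') * (s * Q))) ^ j) :=
              ENNReal.tsum_le_tsum fun k => ENNReal.tsum_le_tsum fun j => hterm k j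
          _ = _ := by
              simp_rw [ENNReal.tsum_mul_left, ENNReal.tsum_mul_right]
              rw [hT]
    _ = _ := by
        rw [ENNReal.mul_rpow_of_nonneg _ _ (by positivity), ← ENNReal.rpow_mul,
          mul_one_div_cancel hQ.ne', ENNReal.rpow_one]
        ring

/-! ### The rectangle characteristic and the conclusion -/

theorem volume_cube_rpow (hd : 1 ≤ d) (c : EuclideanSpace ℝ (Fin d)) (l α : ℝ) :
    volume (cube c l) ^ (α / d - 1) = ENNReal.ofReal l ^ (α - d) := by
  have hd0 : (d : ℝ) ≠ 0 := by positivity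
  rw [volume_cube, ← ENNReal.rpow_natCast, ← ENNReal.rpow_mul]
  congr 1
  field_simp

theorem le_rectChar {α β p q : ℝ} (hm : 1 ≤ m) (hn : 1 ≤ n)
    (σ ω : Measure (EuclideanSpace ℝ (Fin m) × EuclideanSpace ℝ (Fin n)))
    (a : EuclideanSpace ℝ (Fin m)) (l : ℝ) (b : EuclideanSpace ℝ (Fin n)) (r : ℝ)
    (hl : 0 < l) (hr : 0 < r) :
    ENNReal.ofReal l ^ (α - m) * ENNReal.ofReal r ^ (β - n) *
      ω (rect a l b r) ^ (1 / q) * σ (rect a l b r) ^ (1 / p.conjExponent) ≤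
        rectChar α β p q σ ω := by
  rw [← volume_cube_rpow hm a, ← volume_cube_rpow hn b]
  exact le_iSup_of_le a <| le_iSup_of_le l <| le_iSup_of_le hl <| le_iSup_of_le b <|
    le_iSup_of_le r <| le_iSup_of_le hr le_rfl

end

theorem mainTheorem7 (m n : ℕ) (hm : 1 ≤ m) (hn : 1 ≤ n) (α β p q ε ε' : ℝ)
    (hp : 1 < p) (hpq : p < q)
    (hα₀ : 0 < α / m) (hα₁ : α / m < 1) (hβ₀ : 0 < β / n) (hβ₁ : β / n < 1)
    (hsub : 1 / p - 1 / q < min (α / m) (β / n))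
    (hε₁ : 1 - α / m < ε) (hε₂ : ε < (1 - α / m) / (1 / q + 1 / p.conjExponent))
    (hε'₁ : 1 - β / n < ε') (hε'₂ : ε' < (1 - β / n) / (1 / q + 1 / p.conjExponent))
    (D K : ℝ≥0) :
    ∃ C : ℝ≥0,
      ∀ (σ ω : Measure (EuclideanSpace ℝ (Fin m) × EuclideanSpace ℝ (Fin n)))
        [IsLocallyFiniteMeasure σ] [IsLocallyFiniteMeasure ω],
        ProductDoubling D σ → ProductDoubling D ω →
        ProductReverseDoubling ε ε' K σ → ProductReverseDoubling ε ε' K ω →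
        rectChar α β p q σ ω < ∞ →
        ∀ (a : EuclideanSpace ℝ (Fin m)) (l : ℝ) (b : EuclideanSpace ℝ (Fin n)) (r : ℝ),
          0 < l → 0 < r →
          (∫⁻ z, fracInt α β (σ.restrict (rect a l b r)) z ^ q ∂ω) ^ (1 / q) ≤
              C * rectChar α β p q σ ω * σ (rect a l b r) ^ (1 / p) ∧
          (∫⁻ z, fracInt α β (ω.restrict (rect a l b r)) z ^ p.conjExponent ∂σ) ^
                (1 / p.conjExponent) ≤
              C * rectChar α β p q σ ω * ω (rect a l b r) ^ (1 / q.conjExponent) := by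
  have hm0 : (0 : ℝ) < m := by exact_mod_cast hm
  have hn0 : (0 : ℝ) < n := by exact_mod_cast hn
  have hα : α < m := (div_lt_one hm0).1 hα₁
  have hβ : β < n := (div_lt_one hn0).1 hβ₁
  have hq : 1 < q := hp.trans hpq
  have hpc := Real.HolderConjugate.conjExponent hp
  have hqc := Real.HolderConjugate.conjExponent hq
  have hp' : 1 - 1 / p.conjExponent = 1 / p := by
    have := hpc.inv_add_inv_eq_one
    simp only [one_div]; linarith
  have hq' : 1 - 1 / q = 1 / q.conjExponent := by
    have := hqc.inv_add_inv_eq_one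
    simp only [one_div]; linarith
  have hp'1 : 1 / p.conjExponent ≤ 1 := by
    have : 0 < 1 / p := one_div_pos.2 hpc.pos
    linarith
  have hq1 : 1 / q ≤ 1 := by
    have : 0 < 1 / q.conjExponent := one_div_pos.2 hqc.symm.pos
    linarith
  -- Direct inequality: `Q = q`, `s = 1/p'`, so `1 - s = 1/p`.
  obtain ⟨C₁, h₁⟩ := exists_testing_const hm hn hα hβ (zero_lt_one.trans hq)
    (one_div_pos.2 hpc.symm.pos) hp'1 hε₁ hε'₁ D K
  -- Dual inequality: `Q = p'`, `s = 1/q`, so `1 - s = 1/q'`; it is applied with `σ` and `ω`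
  -- exchanged.
  obtain ⟨C₂, h₂⟩ := exists_testing_const hm hn hα hβ hpc.symm.pos
    (one_div_pos.2 hqc.pos) hq1 hε₁ hε'₁ D K
  refine ⟨max C₁ C₂, fun σ ω _ _ hDσ hDω hKσ hKω _ a l b r hl hr => ⟨?_, ?_⟩⟩
  · refine (h₁ σ ω _ hDσ hKσ (le_rectChar hm hn σ ω) a l b r hl hr).trans ?_
    rw [hp']
    gcongr
    exact le_max_left _ _
  · refine (h₂ ω σ (rectChar α β p q σ ω) hDω hKω (fun a l b r hl hr => ?_) a l b r hl hr).trans ?_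
    · exact (mul_right_comm _ _ _).trans_le (le_rectChar hm hn σ ω a l b r hl hr)
    · rw [hq']
      gcongr
      exact le_max_right _ _
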